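/- **Definitions.** Let $d\ge 2$, let $\mathbb S^{d-1}=\{u\in\mathbb R^d:\|u\|_2=1\}$, and let $\varepsilon\in\mathbb R$. An *$\varepsilon$-DP local randomizer* $\mathcal R:\mathbb S^{d-1}\to\mathbb R^d$ assigns to each $v\in\mathbb S^{d-1}$, measurably in $v$, a random vector $\mathcal R(v)\in\mathbb R^d$ (that is, it is a Markov kernel) such that for all $v,v'\in\mathbb S^{d-1}$ and every Borel set $E\subseteq\mathbb R^d$ $$e^{-\varepsilon}\,\mathbb P(\mathcal R(v)\in E)\le \mathbb P(\mathcal R(v')\in E)\le e^{\varepsilon}\,\mathbb P(\mathcal R(v)\in E).$$ It is *unbiased* if $\mathbb E[\mathcal R(v)]=v$ for all $v\in\mathbb S^{d-1}$. Its error (for additive aggregation, one user) is $\mathrm{err}(\mathcal R)=\sup_{v\in\mathbb S^{d-1}}\mathbb E\big[\|\mathcal R(v)-v\|_2^2\big]\in[0,\infty]$. For $p,\gamma\in[0,1]$, $\mathrm{PrivUnit}(p,\gamma)$ is the following randomizer. On input $v\in\mathbb S^{d-1}$, with probability $p$ draw $V$ uniformly from $\{u\in\mathbb S^{d-1}:\langle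 u,v\rangle\ge\gamma\}$, and with probability $1-p$ draw $V$ uniformly from $\{u\in\mathbb S^{d-1}:\langle u,v\rangle<\gamma\}$; return $\frac1m V$, where, with $\alpha=\frac{d-1}2$, $\tau=\frac{1+\gamma}2$, $B(x;a,b)=\int_0^x t^{a-1}(1-t)^{b-1}\,dt$ and $B(a,b)=B(1;a,b)$, $$m=\frac{(1-\gamma^2)^{\alpha}}{2^{d-2}(d-1)}\left(\frac{p}{B(\alpha,\alpha)-B(\tau;\alpha,\alpha)}-\frac{1-p}{B(\tau;\alpha,\alpha)}\right).$$ **Proposition.** Let $\mathcal R:\mathbb S^{d-1}\to\mathbb R^d$ be an unbiased $\varepsilon$-DP local randomizer. Then there are $p^\star\in[0,1]$ and $\gamma^\star\in[0,1]$ such that $\mathrm{PrivUnit}(p^\star,\gamma^\star)$ is well defined (in particular $m\ne0$), is an $\varepsilon$-DP local randomizer, is unbiased, and satisfies $$\mathrm{err}(\mathrm{PrivUnit}(p^\star,\gamma^\star))\le\mathrm{err}(\mathcal R).$$ -/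

import Mathlib

open MeasureTheory
open scoped ENNReal

/-- Euclidean space `ℝ^d` with the `ℓ₂` norm. -/
abbrev Rd (d : ℕ) : Type := EuclideanSpace ℝ (Fin d)

/-- The unit sphere `S^{d-1}` of `ℝ^d`. -/
abbrev UnitSphere (d : ℕ) : Type := Metric.sphere (0 : Rd d) 1

/-- `ε`-closeness of two distributions: `e^{-ε} P(E) ≤ Q(E) ≤ e^ε P(E)` for every event `E`. -/
def DPClose {Y : Type*} [MeasurableSpace Y] (ε : ℝ) (P Q : Measure Y) : Prop :=
  ∀ E : Set Y, MeasurableSet E →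
    Real.exp (-ε) * P.real E ≤ Q.real E ∧ Q.real E ≤ Real.exp ε * P.real E

/-- `R`, given by the output law `R x` at each input `x`, is a (replacement) `ε`-DP local
randomizer: it is a Markov kernel, and its output laws at any two inputs are `ε`-close. -/
structure IsDPLocalRandomizer {X Y : Type*} [MeasurableSpace X] [MeasurableSpace Y]
    (ε : ℝ) (R : X → Measure Y) : Prop where
  measurable : Measurable R
  isProbabilityMeasure : ∀ x, IsProbabilityMeasure (R x)
  close : ∀ x x', DPClose ε (R x) (R x')

/-- `E[R(v)] = v` for every unit vector `v` (the expectation exists and equals `v`). -/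
def IsUnbiased {d : ℕ} (R : UnitSphere d → Measure (Rd d)) : Prop :=
  ∀ v : UnitSphere d, Integrable (fun z : Rd d => z) (R v) ∧ ∫ z, z ∂(R v) = (v : Rd d)

/-- The error `err(R) = sup_v E ‖R(v) - v‖²` of a canonical randomizer, in `[0, ∞]`. -/
noncomputable def err {d : ℕ} (R : UnitSphere d → Measure (Rd d)) : ℝ≥0∞ :=
  ⨆ v : UnitSphere d, ∫⁻ z, ENNReal.ofReal (‖z - (v : Rd d)‖ ^ 2) ∂(R v)

/-- The incomplete Beta function `B(x; a, b) = ∫₀ˣ t^{a-1} (1-t)^{b-1} dt`. -/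
noncomputable def incBeta (x a b : ℝ) : ℝ :=
  ∫ t in (0 : ℝ)..x, t ^ (a - 1) * (1 - t) ^ (b - 1)

/-- The normalization constant `m` of `PrivUnit(p, γ)` in dimension `d ≥ 2`:
with `α = (d-1)/2` and `τ = (1+γ)/2`,
`m = (1-γ²)^α / (2^{d-2} (d-1)) * (p / (B(1; α, α) - B(τ; α, α)) - (1-p) / B(τ; α, α))`. -/
noncomputable def privUnitNorm (d : ℕ) (p γ : ℝ) : ℝ :=
  let α : ℝ := ((d : ℝ) - 1) / 2
  let τ : ℝ := (1 + γ) / 2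
  (1 - γ ^ 2) ^ α / (2 ^ (d - 2) * ((d : ℝ) - 1)) *
    (p / (incBeta 1 α α - incBeta τ α α) - (1 - p) / incBeta τ α α)

/-- The uniform distribution on a subset `A` of the unit sphere: normalized surface measure. -/
noncomputable def uniformOnSphere {d : ℕ} (A : Set (UnitSphere d)) : Measure (UnitSphere d) :=
  ProbabilityTheory.cond (volume : Measure (Rd d)).toSphere A

/-- The output law of `PrivUnit(p, γ)` at the input `v`: with probability `p` draw `V` uniformly
from the cap `{u : ⟪u, v⟫ ≥ γ}`, with probability `1 - p` draw `V` uniformly from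
`{u : ⟪u, v⟫ < γ}`, and return `(1/m) V`. -/
noncomputable def privUnit (d : ℕ) (p γ : ℝ) (v : UnitSphere d) : Measure (Rd d) :=
  Measure.map (fun u : UnitSphere d => (1 / privUnitNorm d p γ) • (u : Rd d))
    (ENNReal.ofReal p •
        uniformOnSphere {u : UnitSphere d | γ ≤ inner ℝ (u : Rd d) (v : Rd d)} +
      ENNReal.ofReal (1 - p) •
        uniformOnSphere {u : UnitSphere d | inner ℝ (u : Rd d) (v : Rd d) < γ})

/-! The proof compares both sides through one number, a threshold `l`. If ε ≤ 0, privacy makes all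
output laws equal, which contradicts unbiasedness; so c = e^ε > 1. With t = ⟪u, v⟫ for u on the
sphere, let l in (0, 1) be a root of ∫ max (t - l) (c (t - l)) = 0; it does not depend on v
(`exists_threshold`).

Lower bound (`one_le_mul_of_first_moment_le`): the infimum ν of all output laws satisfies ν ≤ R v ≤
c ν, so ∫ f d(R v) ≤ ∫ max f (c f) dν. For f(z) = ⟪z, v⟫ - l‖z‖ the left side is 1 - l E‖R(v)‖.
Integrating over v annihilates the right side: for fixed z, homogeneity turns the integral over v
into ‖z‖ times the root equation. Hence 1 ≤ l K for every bound K on the first moments. By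
unbiasedness and nonnegativity of the variance, K = √(err R + 1) is such a bound.

Attainment (`exists_privUnit_of_threshold`): the density proportional to c on the cap t ≥ l and to 1
off it is private, and the root equation says exactly that its mean is l v. So m = l, the output has
constant norm 1/l, and the error is 1/l² - 1, which matches the lower bound. Identifying the Beta
expression for m with this mean needs the law of t, proportional to the image of sin^(d-2) θ dθ
under cos (`exists_cap_moments`). -/

/-! ### Surface measure and its rotation invariance -/

-- `Measure.toSphere` measures a set through the volume of the open cone over it; describing the
-- cone by norm and direction makes it accessible to isometries and to polar coordinates.
open scoped Pointwise in
theorem ioo_smul_image_sphere {E : Type*} [NormedAddCommGroup E] [NormedSpace ℝ E]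
    (s : Set (Metric.sphere (0 : E) 1)) :
    Set.Ioo (0 : ℝ) 1 • (Subtype.val '' s) =
      {x : E | 0 < ‖x‖ ∧ ‖x‖ < 1 ∧ ∃ u ∈ s, (u : E) = ‖x‖⁻¹ • x} := by
  ext x
  simp only [Set.mem_smul, Set.mem_Ioo, Set.mem_image, Set.mem_ofPred_eq]
  constructor
  · rintro ⟨r, ⟨h0, h1⟩, _, ⟨u, hu, rfl⟩, rfl⟩
    have : ‖r • (u : E)‖ = r := by simp [norm_smul, abs_of_pos h0]
    rw [this]
    exact ⟨h0, h1, u, hu, by rw [smul_smul, inv_mul_cancel₀ h0.ne', one_smul]⟩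
  · rintro ⟨h0, h1, u, hu, hux⟩
    exact ⟨‖x‖, ⟨h0, h1⟩, u, ⟨u, hu, rfl⟩, by rw [hux, smul_smul, mul_inv_cancel₀ h0.ne', one_smul]⟩

/-- The action of a linear isometry of `ℝ^d` on the unit sphere. -/
noncomputable def sphereEquiv {d : ℕ} (T : Rd d ≃ₗᵢ[ℝ] Rd d) : UnitSphere d ≃ᵐ UnitSphere d where
  toFun u := ⟨T u, by simp⟩
  invFun u := ⟨T.symm u, by simp⟩
  left_inv u := by simp
  right_inv u := by simp
  measurable_toFun := by
    apply Measurable.subtype_mk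
    exact T.continuous.measurable.comp measurable_subtype_coe
  measurable_invFun := by
    apply Measurable.subtype_mk
    exact T.symm.continuous.measurable.comp measurable_subtype_coe

@[simp] theorem coe_sphereEquiv {d : ℕ} (T : Rd d ≃ₗᵢ[ℝ] Rd d) (u : UnitSphere d) :
    (sphereEquiv T u : Rd d) = T u := rfl

theorem measurePreserving_sphereEquiv {d : ℕ} (T : Rd d ≃ₗᵢ[ℝ] Rd d) :
    MeasurePreserving (sphereEquiv T) (volume : Measure (Rd d)).toSphere
      (volume : Measure (Rd d)).toSphere := by
  refine ⟨(sphereEquiv T).measurable, ?_⟩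
  ext s hs
  rw [(sphereEquiv T).map_apply, Measure.toSphere_apply' _ ((sphereEquiv T).measurable hs),
    Measure.toSphere_apply' _ hs, ioo_smul_image_sphere, ioo_smul_image_sphere]
  congr 1
  conv_rhs => rw [← T.measurePreserving.measure_preimage_emb T.toHomeomorph.measurableEmbedding]
  congr 1
  ext x
  simp only [Set.mem_ofPred_eq, Set.mem_preimage, T.norm_map, Subtype.exists]
  refine and_congr_right fun _ => and_congr_right fun _ => ?_
  constructor
  · rintro ⟨u, hu, hus, rfl⟩
    exact ⟨T (‖x‖⁻¹ • x), by simpa [norm_smul] using hu, hus, by simp⟩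
  · rintro ⟨u, hu, hus, rfl⟩
    refine ⟨‖x‖⁻¹ • x, by simpa [norm_smul] using hu, ?_, rfl⟩
    have : sphereEquiv T ⟨‖x‖⁻¹ • x, by simpa [norm_smul] using hu⟩ = ⟨‖x‖⁻¹ • T x, hu⟩ :=
      Subtype.ext (by simp)
    rw [this]; exact hus

theorem exists_isometry_map_eq {d : ℕ} (v w : UnitSphere d) :
    ∃ T : Rd d ≃ₗᵢ[ℝ] Rd d, T v = w :=
  ⟨_, Submodule.reflection_sub (by simp)⟩

theorem inner_sphereEquiv {d : ℕ} {T : Rd d ≃ₗᵢ[ℝ] Rd d} {v w : UnitSphere d} (h : T v = w)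
    (u : UnitSphere d) : inner ℝ (sphereEquiv T u : Rd d) (w : Rd d) = inner ℝ (u : Rd d) v := by
  rw [← h, coe_sphereEquiv, T.inner_map_map]

theorem map_inner_toSphere {d : ℕ} (v w : UnitSphere d) :
    (volume : Measure (Rd d)).toSphere.map (fun u : UnitSphere d => inner ℝ (u : Rd d) (v : Rd d)) =
      (volume : Measure (Rd d)).toSphere.map (fun u : UnitSphere d => inner ℝ (u : Rd d) (w : Rd d)) := by
  obtain ⟨T, hT⟩ := exists_isometry_map_eq v w
  conv_rhs => rw [← (measurePreserving_sphereEquiv T).map_eq]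
  rw [Measure.map_map (by fun_prop) (sphereEquiv T).measurable]
  congr 1
  ext u
  exact (inner_sphereEquiv hT u).symm

theorem integrable_of_continuous_toSphere {d : ℕ} {F : Type*} [NormedAddCommGroup F]
    [SecondCountableTopology F] {f : UnitSphere d → F} (hf : Continuous f) :
    Integrable f (volume : Measure (Rd d)).toSphere :=
  hf.integrable_of_hasCompactSupport (HasCompactSupport.of_compactSpace f)

/-- The reflection fixing the line of v and negating its orthogonal complement preserves the set and
the measure. It therefore fixes the integral, which must lie on that line; pairing with v gives the
coefficient. -/
theorem setIntegral_inner_preimage_eq {d : ℕ} (v : UnitSphere d) {B : Set ℝ} :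
    ∫ u in {u : UnitSphere d | inner ℝ (u : Rd d) (v : Rd d) ∈ B}, (u : Rd d)
        ∂(volume : Measure (Rd d)).toSphere =
      (∫ u in {u : UnitSphere d | inner ℝ (u : Rd d) (v : Rd d) ∈ B}, inner ℝ (u : Rd d) (v : Rd d)
        ∂(volume : Measure (Rd d)).toSphere) • (v : Rd d) := by
  set s := {u : UnitSphere d | inner ℝ (u : Rd d) (v : Rd d) ∈ B}
  set T : Rd d ≃ₗᵢ[ℝ] Rd d := Submodule.reflection (Submodule.span ℝ {(v : Rd d)})
  have hTv : T v = v := Submodule.reflection_mem_subspace_eq_self (Submodule.mem_span_singleton_self _)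
  have hs : (sphereEquiv T) ⁻¹' s = s := by
    ext u
    simp only [s, Set.mem_preimage, Set.mem_ofPred_eq, inner_sphereEquiv hTv]
  have hint : IntegrableOn (fun u : UnitSphere d => (u : Rd d)) s
      (volume : Measure (Rd d)).toSphere :=
    (integrable_of_continuous_toSphere continuous_subtype_val).integrableOn
  set I := ∫ u in s, (u : Rd d) ∂(volume : Measure (Rd d)).toSphere with hI
  have hTI : T I = I := by
    conv_rhs => rw [hI, ← (measurePreserving_sphereEquiv T).setIntegral_preimage_emb
      (sphereEquiv T).measurableEmbedding, hs]
    rw [hI]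
    exact (T.toContinuousLinearEquiv.toContinuousLinearMap.integral_comp_comm hint).symm
  have hmem : I ∈ Submodule.span ℝ {(v : Rd d)} := (Submodule.reflection_eq_self_iff I).1 hTI
  obtain ⟨c, hc⟩ := Submodule.mem_span_singleton.1 hmem
  have h2 : ∫ u in s, inner ℝ (u : Rd d) (v : Rd d) ∂(volume : Measure (Rd d)).toSphere
      = inner ℝ I (v : Rd d) := by
    rw [real_inner_comm, ← integral_inner hint]
    simp_rw [real_inner_comm]
  rw [h2, ← hc, real_inner_smul_left, real_inner_self_eq_norm_sq]
  simp

/-! ### Polar coordinates and the law of one coordinate on the sphere -/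

theorem lintegral_fun_norm_addHaar {E : Type*} [NormedAddCommGroup E] [NormedSpace ℝ E]
    [MeasurableSpace E] [Nontrivial E] (μ : Measure E) [FiniteDimensional ℝ E] [BorelSpace E]
    [μ.IsAddHaarMeasure] {f : ℝ → ℝ≥0∞} (hf : Measurable f) :
    ∫⁻ x, f ‖x‖ ∂μ = μ.toSphere Set.univ *
      ∫⁻ y in Set.Ioi (0 : ℝ), ENNReal.ofReal (y ^ (Module.finrank ℝ E - 1)) * f y :=
  calc
    ∫⁻ x, f ‖x‖ ∂μ = ∫⁻ x : ({(0)}ᶜ : Set E), f ‖x.1‖ ∂(μ.comap (↑)) := by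
      rw [lintegral_subtype_comap (measurableSet_singleton _).compl fun x ↦ f ‖x‖,
        MeasureTheory.restrict_compl_singleton]
    _ = ∫⁻ x, f x.2 ∂μ.toSphere.prod (.volumeIoiPow (Module.finrank ℝ E - 1)) := by
      simpa using μ.measurePreserving_homeomorphUnitSphereProd.lintegral_comp_emb
        (Homeomorph.measurableEmbedding _) (f ∘ Subtype.val ∘ Prod.snd)
    _ = μ.toSphere Set.univ *
          ∫⁻ x : Set.Ioi (0 : ℝ), f x ∂.volumeIoiPow (Module.finrank ℝ E - 1) := by
      rw [lintegral_prod _ (by fun_prop)]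
      simp only [lintegral_const, mul_comm]
    _ = _ := by
      rw [Measure.volumeIoiPow, lintegral_withDensity_eq_lintegral_mul _ (by fun_prop)
        (by fun_prop)]
      simp only [Pi.mul_apply]
      rw [lintegral_subtype_comap measurableSet_Ioi
        fun a ↦ ENNReal.ofReal (a ^ (Module.finrank ℝ E - 1)) * f a]

/-- Splitting off the first coordinate of a Euclidean space. -/
noncomputable def euclideanSplit (n : ℕ) : EuclideanSpace ℝ (Fin (n + 1)) → ℝ × EuclideanSpace ℝ (Fin n) :=
  fun x => (x 0, WithLp.toLp 2 (fun i => x i.succ))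

theorem measurePreserving_euclideanSplit (n : ℕ) :
    MeasurePreserving (euclideanSplit n) volume volume := by
  have h1 := PiLp.volume_preserving_ofLp (Fin (n + 1))
  have h2 := volume_preserving_piFinSuccAbove (fun _ : Fin (n + 1) => ℝ) 0
  have h3 := (MeasurePreserving.id (volume : Measure ℝ)).prod (PiLp.volume_preserving_toLp (Fin n))
  exact h3.comp (h2.comp h1)

theorem norm_eq_sqrt_euclideanSplit (n : ℕ) (x : EuclideanSpace ℝ (Fin (n + 1))) :
    ‖x‖ = √((euclideanSplit n x).1 ^ 2 + ‖(euclideanSplit n x).2‖ ^ 2) := by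
  rw [EuclideanSpace.norm_eq, EuclideanSpace.norm_sq_eq, Fin.sum_univ_succ]
  simp [euclideanSplit]

/-- Integrating out the direction of the last n + 1 coordinates leaves their radius s with weight
s^n. Planar polar coordinates a = r cos θ, s = r sin θ add a factor r, whence r^(n+1) sin^n θ. -/
theorem lintegral_euclidean_coord_norm (n : ℕ) {F : ℝ × ℝ → ℝ≥0∞} (hF : Measurable F) :
    ∫⁻ x : EuclideanSpace ℝ (Fin (n + 2)), F (x 0, ‖x‖) =
      (volume : Measure (Rd (n + 1))).toSphere Set.univ *
      ((∫⁻ r in Set.Ioi (0 : ℝ), ∫⁻ θ in Set.Ioo 0 Real.pi,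
        ENNReal.ofReal (r ^ (n + 1)) * (ENNReal.ofReal (Real.sin θ ^ n) *
          F (r * Real.cos θ, r)))) := by
  set K := (volume : Measure (Rd (n + 1))).toSphere Set.univ
  calc
    _ = ∫⁻ x : EuclideanSpace ℝ (Fin (n + 2)), (fun p : ℝ × EuclideanSpace ℝ (Fin (n + 1)) =>
          F (p.1, √(p.1 ^ 2 + ‖p.2‖ ^ 2))) (euclideanSplit (n + 1) x) := by
      simp_rw [norm_eq_sqrt_euclideanSplit]; rfl
    _ = ∫⁻ p : ℝ × EuclideanSpace ℝ (Fin (n + 1)), F (p.1, √(p.1 ^ 2 + ‖p.2‖ ^ 2)) :=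
      (measurePreserving_euclideanSplit (n + 1)).lintegral_comp (f := fun p =>
        F (p.1, √(p.1 ^ 2 + ‖p.2‖ ^ 2))) (by fun_prop)
    _ = ∫⁻ a : ℝ, ∫⁻ y : EuclideanSpace ℝ (Fin (n + 1)), F (a, √(a ^ 2 + ‖y‖ ^ 2)) := by
      rw [Measure.volume_eq_prod, lintegral_prod _ (by fun_prop)]
    _ = ∫⁻ a : ℝ, K * ∫⁻ s in Set.Ioi (0 : ℝ),
          ENNReal.ofReal (s ^ n) * F (a, √(a ^ 2 + s ^ 2)) := by
      refine lintegral_congr fun a => ?_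
      rw [lintegral_fun_norm_addHaar volume (f := fun s => F (a, √(a ^ 2 + s ^ 2)))
        (by fun_prop)]
      simp [K]
    _ = K * ∫⁻ a : ℝ, ∫⁻ s : ℝ, (Set.Ioi (0 : ℝ)).indicator
          (fun s => ENNReal.ofReal (s ^ n) * F (a, √(a ^ 2 + s ^ 2))) s := by
      rw [lintegral_const_mul']
      · simp_rw [lintegral_indicator measurableSet_Ioi]
      · exact measure_ne_top _ _
    _ = K * ∫⁻ p : ℝ × ℝ, (Set.univ ×ˢ Set.Ioi (0 : ℝ)).indicator
          (fun p => ENNReal.ofReal (p.2 ^ n) * F (p.1, √(p.1 ^ 2 + p.2 ^ 2))) p := by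
      rw [Measure.volume_eq_prod, lintegral_prod]
      · congr 1
        refine lintegral_congr fun a => lintegral_congr fun s => ?_
        simp [Set.indicator]
      · exact (Measurable.indicator (by fun_prop)
          (MeasurableSet.univ.prod measurableSet_Ioi)).aemeasurable
    _ = _ := by
      congr 1
      rw [← lintegral_comp_polarCoord_symm]
      -- The planar chart has angles in (-π, π); the constraint s > 0 leaves only (0, π).
      have hsub : Set.Ioi (0 : ℝ) ×ˢ Set.Ioo 0 Real.pi ⊆ polarCoord.target := by
        rintro ⟨r, θ⟩ ⟨hr, h0, h1⟩
        exact ⟨hr, by simp only at h0 h1 ⊢; constructor <;> linarith [Real.pi_pos]⟩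
      have hmeas : MeasurableSet (Set.Ioi (0 : ℝ) ×ˢ Set.Ioo 0 Real.pi) :=
        measurableSet_Ioi.prod measurableSet_Ioo
      have h2 : Measurable fun p : ℝ × ℝ => ENNReal.ofReal (p.1 ^ (n + 1)) *
          (ENNReal.ofReal (Real.sin p.2 ^ n) * F (p.1 * Real.cos p.2, p.1)) := by fun_prop
      rw [← lintegral_prod (fun p : ℝ × ℝ => ENNReal.ofReal (p.1 ^ (n + 1)) *
          (ENNReal.ofReal (Real.sin p.2 ^ n) * F (p.1 * Real.cos p.2, p.1))) h2.aemeasurable,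
        Measure.prod_restrict, ← Measure.volume_eq_prod,
        ← Set.inter_eq_self_of_subset_left hsub, ← setLIntegral_indicator hmeas]
      refine setLIntegral_congr_fun polarCoord.open_target.measurableSet ?_
      rintro ⟨r, θ⟩ ⟨hr, h0, h1⟩
      simp only [Set.mem_Ioi] at hr h0 h1
      have hsq : √((r * Real.cos θ) ^ 2 + (r * Real.sin θ) ^ 2) = r := by
        rw [mul_pow, mul_pow, ← mul_add, Real.cos_sq_add_sin_sq, mul_one, Real.sqrt_sq hr.le]
      by_cases hθ : 0 < θ
      · have hs : 0 < Real.sin θ := Real.sin_pos_of_pos_of_lt_pi hθ h1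
        rw [Set.indicator_of_mem (by exact ⟨hr, hθ, h1⟩)]
        simp only [polarCoord_symm_apply, smul_eq_mul]
        rw [Set.indicator_of_mem (by exact ⟨trivial, mul_pos hr hs⟩), hsq, mul_pow, ENNReal.ofReal_mul (by positivity), pow_succ', ENNReal.ofReal_mul hr.le]
        ring
      · have hs : Real.sin θ ≤ 0 := Real.sin_nonpos_of_nonpos_of_neg_pi_le (not_lt.1 hθ) h0.le
        rw [Set.indicator_of_notMem (fun h => hθ h.2.1)]
        simp only [polarCoord_symm_apply, smul_eq_mul]
        rw [Set.indicator_of_notMem, mul_zero]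
        rintro ⟨_, h⟩
        exact absurd h (not_lt.2 (mul_nonpos_of_nonneg_of_nonpos hr.le hs))

/-- The measure `sin θ ^ n dθ` on `(0, π)`. -/
noncomputable def sinPowMeasure (n : ℕ) : Measure ℝ :=
  (volume.restrict (Set.Ioo 0 Real.pi)).withDensity fun θ => ENNReal.ofReal (Real.sin θ ^ n)

theorem integral_sinPowMeasure (n : ℕ) (g : ℝ → ℝ) :
    ∫ θ, g θ ∂sinPowMeasure n = ∫ θ in Set.Ioo 0 Real.pi, Real.sin θ ^ n * g θ := by
  rw [sinPowMeasure, integral_withDensity_eq_integral_toReal_smul (by fun_prop) (by simp)]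
  refine setIntegral_congr_fun measurableSet_Ioo fun θ hθ => ?_
  simp only [smul_eq_mul]
  rw [ENNReal.toReal_ofReal (pow_nonneg (Real.sin_pos_of_mem_Ioo hθ).le n)]

theorem sinPowMeasure_univ_ne_zero (n : ℕ) : sinPowMeasure n Set.univ ≠ 0 := by
  rw [sinPowMeasure, withDensity_apply _ MeasurableSet.univ, Measure.restrict_univ, ne_eq,
    setLIntegral_eq_zero_iff measurableSet_Ioo (by fun_prop)]
  intro h
  have h1 : ∀ᵐ x ∂(volume : Measure ℝ), x ∉ Set.Ioo 0 Real.pi := by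
    filter_upwards [h] with x hx hmem
    have := hx hmem
    simp only [ENNReal.ofReal_eq_zero] at this
    exact absurd this (not_le.2 (pow_pos (Real.sin_pos_of_mem_Ioo hmem) n))
  have h2 : volume (Set.Ioo 0 Real.pi) = 0 := measure_eq_zero_iff_ae_notMem.2 h1
  rw [Real.volume_Ioo, ENNReal.ofReal_eq_zero] at h2
  linarith [Real.pi_pos]

open scoped Pointwise in
theorem toSphere_coord_preimage (n : ℕ) {B : Set ℝ} (hB : MeasurableSet B) :
    (volume : Measure (Rd (n + 2))).toSphere {u | (u : Rd (n + 2)) 0 ∈ B} =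
      ((n + 2 : ℕ) * (volume : Measure (Rd (n + 1))).toSphere Set.univ *
        ∫⁻ r in Set.Ioo (0 : ℝ) 1, ENNReal.ofReal (r ^ (n + 1))) *
          sinPowMeasure n (Real.cos ⁻¹' B) := by
  have hBm : Measurable (B.indicator (1 : ℝ → ℝ≥0∞)) := measurable_one.indicator hB
  -- The indicator of the cone over the set, as a function of first coordinate and norm.
  set F : ℝ × ℝ → ℝ≥0∞ := fun p =>
    (Set.Ioo (0 : ℝ) 1).indicator 1 p.2 * B.indicator 1 (p.2⁻¹ * p.1) with hFdef
  have hF : Measurable F := by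
    have : Measurable ((Set.Ioo (0 : ℝ) 1).indicator (1 : ℝ → ℝ≥0∞)) :=
      measurable_one.indicator measurableSet_Ioo
    fun_prop
  have hs : MeasurableSet {u : UnitSphere (n + 2) | (u : Rd (n + 2)) 0 ∈ B} := by
    have : Measurable fun u : UnitSphere (n + 2) => (u : Rd (n + 2)) 0 := by fun_prop
    exact this hB
  have hset : Set.Ioo (0 : ℝ) 1 • (Subtype.val '' {u : UnitSphere (n + 2) | (u : Rd (n + 2)) 0 ∈ B})
      = {x : Rd (n + 2) | ‖x‖ ∈ Set.Ioo (0 : ℝ) 1 ∧ ‖x‖⁻¹ * x 0 ∈ B} := by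
    rw [ioo_smul_image_sphere]
    ext x
    simp only [Set.mem_ofPred_eq, Set.mem_Ioo, and_assoc]
    refine and_congr_right fun h0 => and_congr_right fun _ => ?_
    constructor
    · rintro ⟨u, hu, hux⟩
      rw [hux] at hu
      simpa using hu
    · intro h
      exact ⟨⟨‖x‖⁻¹ • x, by simp [norm_smul, h0.ne']⟩, by simpa using h, rfl⟩
  have hmeas : MeasurableSet {x : Rd (n + 2) | ‖x‖ ∈ Set.Ioo (0 : ℝ) 1 ∧ ‖x‖⁻¹ * x 0 ∈ B} :=
    (measurableSet_Ioo.preimage measurable_norm).inter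
      (hB.preimage (by fun_prop : Measurable fun x : Rd (n + 2) => ‖x‖⁻¹ * x 0))
  have hvol : volume {x : Rd (n + 2) | ‖x‖ ∈ Set.Ioo (0 : ℝ) 1 ∧ ‖x‖⁻¹ * x 0 ∈ B} =
      ∫⁻ x : Rd (n + 2), F (x 0, ‖x‖) := by
    rw [← lintegral_indicator_one hmeas]
    refine lintegral_congr fun x => ?_
    by_cases h1 : ‖x‖ ∈ Set.Ioo (0 : ℝ) 1 <;> by_cases h2 : ‖x‖⁻¹ * x 0 ∈ B
    · rw [Set.indicator_of_mem (by exact ⟨h1, h2⟩)]; simp only [hFdef]; simp [-Set.mem_Ioo, h1, h2]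
    all_goals
      rw [Set.indicator_of_notMem (fun h => by first | exact h1 h.1 | exact h2 h.2)]
      simp only [hFdef]; simp [-Set.mem_Ioo, h1, h2]
  rw [Measure.toSphere_apply' _ hs, hset, hvol, lintegral_euclidean_coord_norm n hF]
  have hinner : ∀ r ∈ Set.Ioi (0 : ℝ), ∫⁻ θ in Set.Ioo 0 Real.pi,
        ENNReal.ofReal (r ^ (n + 1)) * (ENNReal.ofReal (Real.sin θ ^ n) *
          F (r * Real.cos θ, r)) =
      (Set.Ioo (0 : ℝ) 1).indicator (fun r => ENNReal.ofReal (r ^ (n + 1))) r *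
        sinPowMeasure n (Real.cos ⁻¹' B) := by
    intro r hr
    have hr : 0 < r := hr
    have : sinPowMeasure n (Real.cos ⁻¹' B) = ∫⁻ θ in Set.Ioo 0 Real.pi,
        ENNReal.ofReal (Real.sin θ ^ n) * B.indicator 1 (Real.cos θ) := by
      rw [sinPowMeasure, withDensity_apply _ (Real.measurable_cos hB),
        ← lintegral_indicator (Real.measurable_cos hB)]
      refine lintegral_congr fun θ => ?_
      by_cases h : Real.cos θ ∈ B
      · rw [Set.indicator_of_mem h, Set.indicator_of_mem (by exact h), Pi.one_apply, mul_one]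
      · rw [Set.indicator_of_notMem h, Set.indicator_of_notMem (by exact h), mul_zero]
    rw [this, ← lintegral_const_mul _ (by fun_prop)]
    refine lintegral_congr fun θ => ?_
    rw [show F (r * Real.cos θ, r) = (Set.Ioo (0 : ℝ) 1).indicator 1 r *
      B.indicator 1 (r⁻¹ * (r * Real.cos θ)) from rfl, inv_mul_cancel_left₀ hr.ne']
    by_cases h : r ∈ Set.Ioo (0 : ℝ) 1
    · rw [Set.indicator_of_mem h, Set.indicator_of_mem h, Pi.one_apply, one_mul]
    · rw [Set.indicator_of_notMem h, Set.indicator_of_notMem h]; ring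
  rw [setLIntegral_congr_fun measurableSet_Ioi hinner, lintegral_mul_const _
    (Measurable.indicator (by fun_prop) measurableSet_Ioo), setLIntegral_indicator measurableSet_Ioo]
  rw [Set.inter_eq_self_of_subset_left (fun x hx => hx.1)]
  simp [mul_assoc]

/-- Rotation invariance reduces v to the first basis vector. The constant is never evaluated: it is
nonzero and finite because the total surface mass is. -/
theorem exists_map_inner_toSphere_eq (n : ℕ) : ∃ C : ℝ≥0∞, C ≠ 0 ∧ C ≠ ∞ ∧
    ∀ v : UnitSphere (n + 2),
      (volume : Measure (Rd (n + 2))).toSphere.map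
        (fun u : UnitSphere (n + 2) => inner ℝ (u : Rd (n + 2)) (v : Rd (n + 2))) =
      C • (sinPowMeasure n).map Real.cos := by
  set C := ((n + 2 : ℕ) * (volume : Measure (Rd (n + 1))).toSphere Set.univ *
        ∫⁻ r in Set.Ioo (0 : ℝ) 1, ENNReal.ofReal (r ^ (n + 1)))
  have huniv := toSphere_coord_preimage n MeasurableSet.univ
  simp only [Set.mem_univ, Set.ofPred_true, Set.preimage_univ] at huniv
  have h0 : (volume : Measure (Rd (n + 2))).toSphere Set.univ ≠ 0 := by
    rw [ne_eq, Measure.measure_univ_eq_zero]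
    exact Measure.toSphere_ne_zero _
  refine ⟨C, ?_, ?_, fun v => ?_⟩
  · intro h
    apply h0
    rw [huniv]
    simp only [C] at h
    rw [h, zero_mul]
  · intro h
    have : (volume : Measure (Rd (n + 2))).toSphere Set.univ = ∞ := by
      rw [huniv]
      simp only [C] at h
      rw [h, ENNReal.top_mul (sinPowMeasure_univ_ne_zero n)]
    exact measure_ne_top _ _ this
  · let e : UnitSphere (n + 2) := ⟨EuclideanSpace.single 0 1, by simp⟩
    rw [map_inner_toSphere v e]
    ext B hB
    rw [Measure.map_apply (by fun_prop) hB, Measure.smul_apply,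
      Measure.map_apply Real.measurable_cos hB, smul_eq_mul, ← toSphere_coord_preimage n hB]
    congr 1
    ext u
    simp [e, EuclideanSpace.inner_single_right]

theorem exists_integral_inner_toSphere_eq (n : ℕ) : ∃ C : ℝ, 0 < C ∧
    ∀ (v : UnitSphere (n + 2)) (g : ℝ → ℝ), Measurable g →
      ∫ u, g (inner ℝ (u : Rd (n + 2)) (v : Rd (n + 2)))
          ∂(volume : Measure (Rd (n + 2))).toSphere =
        C * ∫ θ in Set.Ioo 0 Real.pi, Real.sin θ ^ n * g (Real.cos θ) := by
  obtain ⟨C, h0, htop, hC⟩ := exists_map_inner_toSphere_eq n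
  refine ⟨C.toReal, ENNReal.toReal_pos h0 htop, fun v g hg => ?_⟩
  rw [← integral_map (φ := fun u : UnitSphere (n + 2) => inner ℝ (u : Rd (n + 2)) (v : Rd (n + 2)))
    (by fun_prop) hg.aestronglyMeasurable, hC v, integral_smul_measure,
    integral_map Real.measurable_cos.aemeasurable hg.aestronglyMeasurable, integral_sinPowMeasure,
    smul_eq_mul]

/-! ### Incomplete Beta functions as integrals of powers of sine -/

/-- Substitution `s = (1 + cos θ) / 2` in a symmetric beta integrand. -/
theorem beta_substitution (n : ℕ) {a b : ℝ} (ha : 0 ≤ a) (hb : b ≤ Real.pi) :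
    let α : ℝ := (((n + 2 : ℕ) : ℝ) - 1) / 2
    let f : ℝ → ℝ := fun t => t ^ (α - 1) * (1 - t) ^ (α - 1)
    let s : Set ℝ := (fun θ => (1 + Real.cos θ) / 2) '' Set.Ioo a b
    IntegrableOn f s ∧ ∫ t in s, f t = (2 ^ n)⁻¹ * ∫ θ in Set.Ioo a b, Real.sin θ ^ n := by
  intro α f s
  have hder : ∀ θ ∈ Set.Ioo a b, HasDerivWithinAt (fun θ => (1 + Real.cos θ) / 2)
      (-Real.sin θ / 2) (Set.Ioo a b) θ := fun θ _ =>
    (((Real.hasDerivAt_cos θ).const_add 1).div_const 2).hasDerivWithinAt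
  have hsub : Set.Ioo a b ⊆ Set.Icc 0 Real.pi := fun x hx =>
    ⟨ha.trans hx.1.le, hx.2.le.trans hb⟩
  have hinj : Set.InjOn (fun θ => (1 + Real.cos θ) / 2) (Set.Ioo a b) := by
    intro x hx y hy hxy
    refine Real.injOn_cos (hsub hx) (hsub hy) ?_
    simp only at hxy
    linarith
  -- Here t(1 - t) = (sin θ / 2)², and the Jacobian supplies one more factor sin θ / 2, for the
  -- exponent 2(α - 1) + 1 = n. This also absorbs the endpoint singularities present when n = 0.
  have heq : ∀ θ ∈ Set.Ioo a b, |-Real.sin θ / 2| • f ((1 + Real.cos θ) / 2) =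
      (2 ^ n)⁻¹ * Real.sin θ ^ n := by
    intro θ hθ
    have hs : 0 < Real.sin θ :=
      Real.sin_pos_of_pos_of_lt_pi (ha.trans_lt hθ.1) (hθ.2.trans_le hb)
    have hsq := Real.sin_sq_add_cos_sq θ
    have hc1 : 0 ≤ (1 + Real.cos θ) / 2 := by linarith [Real.neg_one_le_cos θ]
    have hc2 : 0 ≤ 1 - (1 + Real.cos θ) / 2 := by linarith [Real.cos_le_one θ]
    have hprod : (1 + Real.cos θ) / 2 * (1 - (1 + Real.cos θ) / 2) = (Real.sin θ / 2) ^ (2 : ℝ) := by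
      rw [Real.rpow_two]
      nlinarith
    have hh : 0 < Real.sin θ / 2 := by positivity
    simp only [f, smul_eq_mul]
    rw [← Real.mul_rpow hc1 hc2, hprod, ← Real.rpow_mul hh.le, neg_div, abs_neg, abs_of_pos hh,
      mul_comm, ← Real.rpow_add_one hh.ne']
    have : 2 * (α - 1) + 1 = (n : ℝ) := by simp only [α]; push_cast; ring
    rw [this, Real.rpow_natCast, div_pow, div_eq_inv_mul]
  constructor
  · rw [integrableOn_image_iff_integrableOn_abs_deriv_smul measurableSet_Ioo hder hinj,
      integrableOn_congr_fun heq measurableSet_Ioo]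
    exact ((Continuous.integrableOn_Icc (by fun_prop)).mono_set Set.Ioo_subset_Icc_self)
  · rw [integral_image_eq_integral_abs_deriv_smul measurableSet_Ioo hder hinj,
      setIntegral_congr_fun measurableSet_Ioo heq, integral_const_mul]

theorem image_half_one_add_cos_Ioo {a b : ℝ} (ha : 0 ≤ a) (hab : a ≤ b) (hb : b ≤ Real.pi) :
    (fun θ => (1 + Real.cos θ) / 2) '' Set.Ioo a b =
      Set.Ioo ((1 + Real.cos b) / 2) ((1 + Real.cos a) / 2) := by
  have hanti : StrictAntiOn Real.cos (Set.Icc a b) :=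
    Real.strictAntiOn_cos.mono (Set.Icc_subset_Icc ha hb)
  have hcos : Real.cos '' Set.Ioo a b = Set.Ioo (Real.cos b) (Real.cos a) := by
    apply Set.Subset.antisymm
    · rintro _ ⟨x, hx, rfl⟩
      exact ⟨hanti (Set.Ioo_subset_Icc_self hx) (Set.right_mem_Icc.2 hab) hx.2,
        hanti (Set.left_mem_Icc.2 hab) (Set.Ioo_subset_Icc_self hx) hx.1⟩
    · exact intermediate_value_Ioo' hab Real.continuous_cos.continuousOn
  have h1 : (fun θ => (1 + Real.cos θ) / 2) = (fun c => (1 + c) / 2) ∘ Real.cos := rfl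
  rw [h1, Set.image_comp, hcos]
  ext x
  simp only [Set.mem_image, Set.mem_Ioo]
  constructor
  · rintro ⟨c, ⟨h1, h2⟩, rfl⟩
    constructor <;> linarith
  · rintro ⟨h1, h2⟩
    exact ⟨2 * x - 1, ⟨by linarith, by linarith⟩, by ring⟩

theorem incBeta_eq_sin_integrals (n : ℕ) {γ : ℝ} (h0 : -1 ≤ γ) (h1 : γ ≤ 1) :
    let α : ℝ := (((n + 2 : ℕ) : ℝ) - 1) / 2
    let τ : ℝ := (1 + γ) / 2
    incBeta 1 α α - incBeta τ α α =
        (2 ^ n)⁻¹ * ∫ θ in Set.Ioo 0 (Real.arccos γ), Real.sin θ ^ n ∧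
      incBeta τ α α = (2 ^ n)⁻¹ * ∫ θ in Set.Ioo (Real.arccos γ) Real.pi, Real.sin θ ^ n := by
  intro α τ
  have hcos := Real.cos_arccos h0 h1
  obtain ⟨hi1, he1⟩ := beta_substitution n (le_refl 0) (Real.arccos_le_pi γ)
  obtain ⟨hi2, he2⟩ := beta_substitution n (Real.arccos_nonneg γ) (le_refl Real.pi)
  rw [image_half_one_add_cos_Ioo le_rfl (Real.arccos_nonneg γ) (Real.arccos_le_pi γ), hcos,
    Real.cos_zero] at hi1 he1
  rw [image_half_one_add_cos_Ioo (Real.arccos_nonneg γ) (Real.arccos_le_pi γ) le_rfl, hcos,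
    Real.cos_pi] at hi2 he2
  norm_num only at hi1 he1 hi2 he2
  have hτ0 : 0 ≤ τ := by simp only [τ]; linarith
  have hτ1 : τ ≤ 1 := by simp only [τ]; linarith
  have hI1 : IntervalIntegrable (fun t : ℝ => t ^ (α - 1) * (1 - t) ^ (α - 1)) volume τ 1 := by
    rw [intervalIntegrable_iff_integrableOn_Ioo_of_le hτ1]
    convert hi1 using 1
  have hI0 : IntervalIntegrable (fun t : ℝ => t ^ (α - 1) * (1 - t) ^ (α - 1)) volume 0 τ := by
    rw [intervalIntegrable_iff_integrableOn_Ioo_of_le hτ0]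
    convert hi2 using 1
  constructor
  · rw [incBeta, incBeta, intervalIntegral.integral_interval_sub_left (hI0.trans hI1) hI0,
      intervalIntegral.integral_of_le hτ1, integral_Ioc_eq_integral_Ioo, ← he1]
  · rw [incBeta, intervalIntegral.integral_of_le hτ0, integral_Ioc_eq_integral_Ioo, ← he2]

/-! ### Masses and first moments of caps -/

/-- The cap `{u : ⟪u, v⟫ ≥ γ}` of the sphere. -/
abbrev sphereCap {d : ℕ} (v : UnitSphere d) (γ : ℝ) : Set (UnitSphere d) :=
  {u | γ ≤ inner ℝ (u : Rd d) (v : Rd d)}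

theorem measurableSet_sphereCap {d : ℕ} (v : UnitSphere d) (γ : ℝ) :
    MeasurableSet (sphereCap v γ) :=
  measurableSet_le measurable_const (by fun_prop)

theorem compl_sphereCap {d : ℕ} (v : UnitSphere d) (γ : ℝ) :
    (sphereCap v γ)ᶜ = {u : UnitSphere d | inner ℝ (u : Rd d) (v : Rd d) < γ} := by
  ext u
  exact not_le (a := γ) (b := inner ℝ (u : Rd d) (v : Rd d))

theorem Ioo_zero_pi_inter_cos_preimage_Ici {γ : ℝ} (h0 : -1 < γ) (h1 : γ ≤ 1) :
    Set.Ioo 0 Real.pi ∩ Real.cos ⁻¹' Set.Ici γ = Set.Ioc 0 (Real.arccos γ) := by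
  -- For γ = -1 the right-hand side would contain π, which the open interval omits.
  have hlt : Real.arccos γ < Real.pi := by
    rcases (Real.arccos_le_pi γ).lt_or_eq with h | h
    · exact h
    · exact absurd (Real.arccos_eq_pi.1 h) (not_le.2 h0)
  have hmem : Real.arccos γ ∈ Set.Icc 0 Real.pi := ⟨Real.arccos_nonneg γ, Real.arccos_le_pi γ⟩
  have key : ∀ θ ∈ Set.Icc 0 Real.pi, (γ ≤ Real.cos θ ↔ θ ≤ Real.arccos γ) := fun θ hθ => by
    rw [← Real.strictAntiOn_cos.le_iff_ge hmem hθ, Real.cos_arccos h0.le h1]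
  ext θ
  constructor
  · rintro ⟨⟨h2, h3⟩, h4⟩
    exact ⟨h2, (key θ ⟨h2.le, h3.le⟩).1 h4⟩
  · rintro ⟨h2, h3⟩
    exact ⟨⟨h2, h3.trans_lt hlt⟩, (key θ ⟨h2.le, h3.trans hlt.le⟩).2 h3⟩

theorem Ioo_zero_pi_inter_cos_preimage_Iio {γ : ℝ} (h0 : -1 < γ) (h1 : γ ≤ 1) :
    Set.Ioo 0 Real.pi ∩ Real.cos ⁻¹' Set.Iio γ = Set.Ioo (Real.arccos γ) Real.pi := by
  have h := Ioo_zero_pi_inter_cos_preimage_Ici h0 h1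
  ext θ
  have hθ : (θ ∈ Set.Ioo 0 Real.pi ∧ γ ≤ Real.cos θ) ↔
      (0 < θ ∧ θ ≤ Real.arccos γ) := by
    simpa using (Set.ext_iff.1 h) θ
  simp only [Set.mem_Ioo] at hθ
  simp only [Set.mem_inter_iff, Set.mem_Ioo, Set.mem_preimage, Set.mem_Iio, ← not_le]
  have := Real.arccos_nonneg γ
  constructor
  · rintro ⟨⟨h2, h3⟩, h4⟩
    exact ⟨fun h5 => h4 (hθ.2 ⟨not_le.1 h2, h5⟩).2, h3⟩
  · rintro ⟨h2, h3⟩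
    have h5 : 0 < θ := this.trans_lt (not_le.1 h2)
    exact ⟨⟨not_le.2 h5, h3⟩, fun h4 => h2 (hθ.1 ⟨⟨h5, not_le.1 h3⟩, h4⟩).2⟩

theorem exists_setIntegral_cap_eq (n : ℕ) : ∃ C : ℝ, 0 < C ∧
    ∀ (v : UnitSphere (n + 2)) (g : ℝ → ℝ), Measurable g → ∀ γ : ℝ, -1 < γ → γ ≤ 1 →
      ∫ u in sphereCap v γ, g (inner ℝ (u : Rd (n + 2)) (v : Rd (n + 2)))
          ∂(volume : Measure (Rd (n + 2))).toSphere =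
        C * ∫ θ in Set.Ioo 0 (Real.arccos γ), Real.sin θ ^ n * g (Real.cos θ) ∧
      ∫ u in (sphereCap v γ)ᶜ, g (inner ℝ (u : Rd (n + 2)) (v : Rd (n + 2)))
          ∂(volume : Measure (Rd (n + 2))).toSphere =
        C * ∫ θ in Set.Ioo (Real.arccos γ) Real.pi, Real.sin θ ^ n * g (Real.cos θ) := by
  obtain ⟨C, hC0, hC⟩ := exists_integral_inner_toSphere_eq n
  refine ⟨C, hC0, fun v g hg γ h0 h1 => ?_⟩
  have key : ∀ B : Set ℝ, MeasurableSet B →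
      ∫ u in {u : UnitSphere (n + 2) | inner ℝ (u : Rd (n + 2)) (v : Rd (n + 2)) ∈ B},
        g (inner ℝ (u : Rd (n + 2)) (v : Rd (n + 2))) ∂(volume : Measure (Rd (n + 2))).toSphere =
      C * ∫ θ in Set.Ioo 0 Real.pi ∩ Real.cos ⁻¹' B, Real.sin θ ^ n * g (Real.cos θ) := by
    intro B hB
    have hm : MeasurableSet
        {u : UnitSphere (n + 2) | inner ℝ (u : Rd (n + 2)) (v : Rd (n + 2)) ∈ B} :=
      hB.preimage (by fun_prop : Measurable
        fun u : UnitSphere (n + 2) => inner ℝ (u : Rd (n + 2)) (v : Rd (n + 2)))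
    rw [← integral_indicator hm, ← setIntegral_indicator (Real.measurable_cos hB)]
    refine (show _ = _ from hC v (B.indicator g) (hg.indicator hB)).trans ?_
    congr 2
    funext θ
    by_cases h : Real.cos θ ∈ B
    · rw [Set.indicator_of_mem h, Set.indicator_of_mem (by exact h)]
    · rw [Set.indicator_of_notMem h, Set.indicator_of_notMem (by exact h), mul_zero]
  have hk1 := key _ (measurableSet_Ici (a := γ))
  have hk2 := key _ (measurableSet_Iio (a := γ))
  rw [Ioo_zero_pi_inter_cos_preimage_Ici h0 h1, integral_Ioc_eq_integral_Ioo] at hk1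
  rw [Ioo_zero_pi_inter_cos_preimage_Iio h0 h1] at hk2
  rw [compl_sphereCap]
  exact ⟨hk1, hk2⟩

theorem setIntegral_sin_pow_mul_cos (n : ℕ) {a b : ℝ} (hab : a ≤ b) :
    ∫ θ in Set.Ioo a b, Real.sin θ ^ n * Real.cos θ =
      (Real.sin b ^ (n + 1) - Real.sin a ^ (n + 1)) / (n + 1) := by
  rw [← integral_Ioc_eq_integral_Ioo, ← intervalIntegral.integral_of_le hab,
    intervalIntegral.integral_eq_sub_of_hasDerivAt
      (f := fun θ => Real.sin θ ^ (n + 1) / (n + 1)) (fun θ _ => ?_)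
      (Continuous.intervalIntegrable (by fun_prop) _ _)]
  · ring
  · have h : (n : ℝ) + 1 ≠ 0 := by positivity
    refine (((Real.hasDerivAt_sin θ).pow (n + 1)).div_const ((n : ℝ) + 1)).congr_deriv ?_
    rw [Nat.add_sub_cancel, Nat.cast_add_one]
    field_simp

theorem setIntegral_sin_pow_pos (n : ℕ) {a b : ℝ} (ha : 0 ≤ a) (hab : a < b) (hb : b ≤ Real.pi) :
    0 < ∫ θ in Set.Ioo a b, Real.sin θ ^ n := by
  rw [← integral_Ioc_eq_integral_Ioo, ← intervalIntegral.integral_of_le hab.le]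
  refine intervalIntegral.intervalIntegral_pos_of_pos_on
    (Continuous.intervalIntegrable (by fun_prop) _ _) (fun x hx => ?_) hab
  exact pow_pos (Real.sin_pos_of_pos_of_lt_pi (ha.trans_lt hx.1) (hx.2.trans_le hb)) n

/-- The masses `a`, `b` of a cap and of its complement and the first moment `A` of the cap
determine the normalization of `PrivUnit`. -/
theorem exists_cap_moments (n : ℕ) {γ : ℝ} (h0 : -1 < γ) (h1 : γ < 1) :
    ∃ a b A : ℝ, 0 < a ∧ 0 < b ∧ 0 < A ∧
      (∀ v : UnitSphere (n + 2),
        (volume : Measure (Rd (n + 2))).toSphere.real (sphereCap v γ) = a ∧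
        (volume : Measure (Rd (n + 2))).toSphere.real (sphereCap v γ)ᶜ = b ∧
        ∫ u in sphereCap v γ, inner ℝ (u : Rd (n + 2)) (v : Rd (n + 2))
          ∂(volume : Measure (Rd (n + 2))).toSphere = A ∧
        ∫ u in (sphereCap v γ)ᶜ, inner ℝ (u : Rd (n + 2)) (v : Rd (n + 2))
          ∂(volume : Measure (Rd (n + 2))).toSphere = -A) ∧
      ∀ p, privUnitNorm (n + 2) p γ = A * (p / a - (1 - p) / b) := by
  obtain ⟨C, hC0, hC⟩ := exists_setIntegral_cap_eq n
  set θ₀ := Real.arccos γ with hθ₀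
  have hpos : 0 < θ₀ := Real.arccos_pos.2 h1
  have hlt : θ₀ < Real.pi := by
    rcases (Real.arccos_le_pi γ).lt_or_eq with h | h
    · exact h
    · exact absurd (Real.arccos_eq_pi.1 h) (not_le.2 h0)
  have hsin : 0 < Real.sin θ₀ := Real.sin_pos_of_pos_of_lt_pi hpos hlt
  have hI1 := setIntegral_sin_pow_pos n le_rfl hpos hlt.le
  have hI2 := setIntegral_sin_pow_pos n hpos.le hlt le_rfl
  obtain ⟨I1, hI1def⟩ : ∃ x, x = ∫ θ in Set.Ioo 0 θ₀, Real.sin θ ^ n := ⟨_, rfl⟩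
  obtain ⟨I2, hI2def⟩ : ∃ x, x = ∫ θ in Set.Ioo θ₀ Real.pi, Real.sin θ ^ n := ⟨_, rfl⟩
  rw [← hI1def] at hI1
  rw [← hI2def] at hI2
  -- The first moment has antiderivative sin^(n+1) θ / (n + 1), which vanishes at 0 and π; the cap
  -- and its complement therefore have opposite moments. C cancels in the quotients A/a and A/b.
  refine ⟨C * I1, C * I2, C * (Real.sin θ₀ ^ (n + 1) / (n + 1)), mul_pos hC0 hI1, mul_pos hC0 hI2,
    by positivity, fun v => ?_, fun p => ?_⟩
  · have h2 := hC v (fun _ => 1) measurable_const γ h0 h1.le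
    have h3 := hC v (fun t => t) measurable_id γ h0 h1.le
    simp only [mul_one, setIntegral_const, smul_eq_mul] at h2
    rw [← hθ₀, ← hI1def, ← hI2def] at h2
    rw [← hθ₀] at h3
    refine ⟨h2.1, h2.2, ?_, ?_⟩
    · rw [h3.1, setIntegral_sin_pow_mul_cos n hpos.le]
      simp
    · rw [h3.2, setIntegral_sin_pow_mul_cos n hlt.le]
      simp
      ring
  · obtain ⟨hB1, hB2⟩ := incBeta_eq_sin_integrals n h0.le h1.le
    simp only [privUnitNorm]
    rw [hB1, hB2, ← hθ₀, ← hI1def, ← hI2def]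
    -- The exponent α is (n + 1)/2 and sin (arccos γ) = √(1 - γ²).
    have hpow : (1 - γ ^ 2) ^ ((((n + 2 : ℕ) : ℝ) - 1) / 2) = Real.sin θ₀ ^ (n + 1) := by
      have hnn : 0 ≤ 1 - γ ^ 2 := by nlinarith
      rw [Real.sin_arccos, Real.sqrt_eq_rpow, ← Real.rpow_mul_natCast hnn]
      congr 1
      push_cast
      ring
    rw [hpow]
    have hn : ((n + 2 : ℕ) : ℝ) - 1 = n + 1 := by push_cast; ring
    rw [hn, Nat.add_sub_cancel]
    field_simp

/-! ### The threshold equation -/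

/-- Since c ≥ 1, the maximum is c(t - l) where t ≥ l and t - l elsewhere, so the equation becomes
linear in cap masses and moments. -/
theorem integral_max_mul_sub_eq {n : ℕ} (v : UnitSphere (n + 2)) {c l : ℝ} (hc : 1 ≤ c) :
    ∫ u : UnitSphere (n + 2), max (inner ℝ (u : Rd (n + 2)) (v : Rd (n + 2)) - l)
        (c * (inner ℝ (u : Rd (n + 2)) (v : Rd (n + 2)) - l))
        ∂(volume : Measure (Rd (n + 2))).toSphere =
      c * (∫ u in sphereCap v l, inner ℝ (u : Rd (n + 2)) (v : Rd (n + 2))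
        ∂(volume : Measure (Rd (n + 2))).toSphere -
          l * (volume : Measure (Rd (n + 2))).toSphere.real (sphereCap v l)) +
      (∫ u in (sphereCap v l)ᶜ, inner ℝ (u : Rd (n + 2)) (v : Rd (n + 2))
        ∂(volume : Measure (Rd (n + 2))).toSphere -
          l * (volume : Measure (Rd (n + 2))).toSphere.real (sphereCap v l)ᶜ) := by
  have hm := measurableSet_sphereCap v l
  have hint : Integrable (fun u : UnitSphere (n + 2) => inner ℝ (u : Rd (n + 2)) (v : Rd (n + 2)))
      (volume : Measure (Rd (n + 2))).toSphere :=
    integrable_of_continuous_toSphere (by fun_prop)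
  have e1 : Set.EqOn (fun u : UnitSphere (n + 2) =>
      max (inner ℝ (u : Rd (n + 2)) (v : Rd (n + 2)) - l)
        (c * (inner ℝ (u : Rd (n + 2)) (v : Rd (n + 2)) - l)))
      (fun u => c * (inner ℝ (u : Rd (n + 2)) (v : Rd (n + 2)) - l)) (sphereCap v l) := by
    intro u hu
    have hu : l ≤ inner ℝ (u : Rd (n + 2)) (v : Rd (n + 2)) := hu
    exact max_eq_right (by nlinarith)
  have e2 : Set.EqOn (fun u : UnitSphere (n + 2) =>
      max (inner ℝ (u : Rd (n + 2)) (v : Rd (n + 2)) - l)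
        (c * (inner ℝ (u : Rd (n + 2)) (v : Rd (n + 2)) - l)))
      (fun u => inner ℝ (u : Rd (n + 2)) (v : Rd (n + 2)) - l) (sphereCap v l)ᶜ := by
    intro u hu
    have hu : ¬ l ≤ inner ℝ (u : Rd (n + 2)) (v : Rd (n + 2)) := hu
    exact max_eq_left (by nlinarith [not_le.1 hu])
  rw [← integral_add_compl hm (integrable_of_continuous_toSphere (by fun_prop)),
    setIntegral_congr_fun hm e1, setIntegral_congr_fun hm.compl e2, integral_const_mul,
    integral_sub hint.integrableOn (integrable_const _), integral_sub hint.integrableOn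
    (integrable_const _), setIntegral_const, setIntegral_const]
  simp only [smul_eq_mul]
  ring

/-- The optimal threshold: the zero of `l ↦ ∫ max (t - l) (c (t - l))`, `t = ⟪u, v⟫`. -/
theorem exists_threshold (n : ℕ) {c : ℝ} (hc : 1 < c) :
    ∃ l ∈ Set.Ioo (0 : ℝ) 1, ∀ v : UnitSphere (n + 2),
      ∫ u : UnitSphere (n + 2), max (inner ℝ (u : Rd (n + 2)) (v : Rd (n + 2)) - l)
        (c * (inner ℝ (u : Rd (n + 2)) (v : Rd (n + 2)) - l))
        ∂(volume : Measure (Rd (n + 2))).toSphere = 0 := by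
  let e : UnitSphere (n + 2) := ⟨EuclideanSpace.single 0 1, by simp⟩
  let H : ℝ → ℝ := fun l => ∫ u : UnitSphere (n + 2),
    max (inner ℝ (u : Rd (n + 2)) (e : Rd (n + 2)) - l)
        (c * (inner ℝ (u : Rd (n + 2)) (e : Rd (n + 2)) - l))
        ∂(volume : Measure (Rd (n + 2))).toSphere
  have hcont : Continuous H := by
    refine (continuous_parametric_integral_of_continuous (s := Set.univ)
      (μ := (volume : Measure (Rd (n + 2))).toSphere)
      (f := fun (l : ℝ) (u : UnitSphere (n + 2)) =>
        max (inner ℝ (u : Rd (n + 2)) (e : Rd (n + 2)) - l)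
          (c * (inner ℝ (u : Rd (n + 2)) (e : Rd (n + 2)) - l)))
      (by unfold Function.uncurry; fun_prop) isCompact_univ).congr fun l => ?_
    simp only [H, Measure.restrict_univ]
  -- At l = 0 the value is (c - 1) A, with A the positive first moment of a hemisphere.
  have hH0 : 0 < H 0 := by
    obtain ⟨a, b, A, -, -, hA, hv, -⟩ := exists_cap_moments n (γ := 0) (by norm_num) (by norm_num)
    obtain ⟨-, -, h3, h4⟩ := hv e
    simp only [H]
    rw [integral_max_mul_sub_eq e hc.le, h3, h4]
    nlinarith
  -- At l = 1 the integrand is t - 1 ≤ 0, and it is strictly negative at the antipode of e.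
  have hH1 : H 1 < 0 := by
    have hle : ∀ u : UnitSphere (n + 2), inner ℝ (u : Rd (n + 2)) (e : Rd (n + 2)) ≤ 1 := fun u => by
      simpa using real_inner_le_norm (u : Rd (n + 2)) (e : Rd (n + 2))
    have hval : ∀ u : UnitSphere (n + 2),
        max (inner ℝ (u : Rd (n + 2)) (e : Rd (n + 2)) - 1)
          (c * (inner ℝ (u : Rd (n + 2)) (e : Rd (n + 2)) - 1)) =
        -(1 - inner ℝ (u : Rd (n + 2)) (e : Rd (n + 2))) := fun u => by
      rw [neg_sub]
      exact max_eq_left (by nlinarith [hle u])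
    simp only [H, hval]
    rw [integral_neg, neg_lt_zero]
    refine Continuous.integral_pos_of_hasCompactSupport_nonneg_nonzero (x := -e) (by fun_prop)
      (HasCompactSupport.of_compactSpace _) (fun u => by simpa using hle u) ?_
    rw [coe_neg_sphere, inner_neg_left, real_inner_self_eq_norm_sq, norm_eq_of_mem_sphere]
    norm_num
  obtain ⟨l, hl, hHl⟩ := intermediate_value_Ioo' zero_le_one hcont.continuousOn
    (show (0 : ℝ) ∈ Set.Ioo (H 1) (H 0) from ⟨hH1, hH0⟩)
  refine ⟨l, hl, fun v => ?_⟩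
  rw [← hHl]
  -- The integral depends only on the law of ⟪u, v⟫, which is the same for v and e.
  have hf : AEStronglyMeasurable (fun t : ℝ => max (t - l) (c * (t - l)))
      ((volume : Measure (Rd (n + 2))).toSphere.map
        (fun u : UnitSphere (n + 2) => inner ℝ (u : Rd (n + 2)) (v : Rd (n + 2)))) := by
    apply Continuous.aestronglyMeasurable; fun_prop
  simp only [H]
  rw [← integral_map (f := fun t : ℝ => max (t - l) (c * (t - l))) (by fun_prop) hf]
  rw [map_inner_toSphere v e] at hf ⊢
  rw [integral_map (by fun_prop) hf]

/-! ### The lower bound from privacy and unbiasedness -/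

theorem DPClose.le_smul {Y : Type*} [MeasurableSpace Y] {ε : ℝ} {P Q : Measure Y}
    [IsFiniteMeasure P] [IsFiniteMeasure Q] (h : DPClose ε P Q) :
    P ≤ ENNReal.ofReal (Real.exp ε) • Q := by
  refine Measure.le_iff.2 fun E hE => ?_
  have h1 := (h E hE).1
  have h2 : P.real E ≤ Real.exp ε * Q.real E := by
    have := mul_le_mul_of_nonneg_left h1 (Real.exp_pos ε).le
    rwa [← mul_assoc, ← Real.exp_add, add_neg_cancel, Real.exp_zero, one_mul] at this
  rw [Measure.smul_apply, smul_eq_mul, ← ofReal_measureReal (μ := P), ← ofReal_measureReal (μ := Q),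
    ← ENNReal.ofReal_mul (Real.exp_pos ε).le]
  exact ENNReal.ofReal_le_ofReal h2

/-- The output laws of a differentially private randomizer are squeezed between their infimum
and a multiple of it. -/
theorem IsDPLocalRandomizer.exists_squeeze {X Y : Type*} [MeasurableSpace X] [MeasurableSpace Y]
    {ε : ℝ} {R : X → Measure Y} (hR : IsDPLocalRandomizer ε R) :
    ∃ ν : Measure Y, ∀ x, ν ≤ R x ∧ R x ≤ ENNReal.ofReal (Real.exp ε) • ν := by
  have := hR.isProbabilityMeasure
  refine ⟨⨅ x, R x, fun x => ⟨iInf_le _ _, ?_⟩⟩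
  have h0 : ENNReal.ofReal (Real.exp ε) ≠ 0 := by simp [Real.exp_pos]
  have h : (ENNReal.ofReal (Real.exp ε))⁻¹ • R x ≤ ⨅ x, R x := by
    refine le_iInf fun y => Measure.le_iff.2 fun E hE => ?_
    have := Measure.le_iff.1 (hR.close x y).le_smul E hE
    rw [Measure.smul_apply, smul_eq_mul] at this ⊢
    calc _ ≤ (ENNReal.ofReal (Real.exp ε))⁻¹ * (ENNReal.ofReal (Real.exp ε) * R y E) := by gcongr
      _ = R y E := by
        rw [← mul_assoc, ENNReal.inv_mul_cancel h0 ENNReal.ofReal_ne_top, one_mul]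
  refine Measure.le_iff.2 fun E hE => ?_
  have := Measure.le_iff.1 h E hE
  rw [Measure.smul_apply, smul_eq_mul] at this ⊢
  calc R x E = ENNReal.ofReal (Real.exp ε) * ((ENNReal.ofReal (Real.exp ε))⁻¹ * R x E) := by
        rw [← mul_assoc, ENNReal.mul_inv_cancel h0 ENNReal.ofReal_ne_top, one_mul]
    _ ≤ _ := by gcongr

/-- For ε ≤ 0 any two output laws dominate each other and so coincide, yet antipodal inputs require
the distinct means e and -e. -/
theorem IsDPLocalRandomizer.eps_pos {d : ℕ} (hd : 0 < d) {ε : ℝ} {R : UnitSphere d → Measure (Rd d)}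
    (hR : IsDPLocalRandomizer ε R) (hunb : IsUnbiased R) : 0 < ε := by
  have := hR.isProbabilityMeasure
  let e : UnitSphere d := ⟨EuclideanSpace.single ⟨0, hd⟩ 1, by simp⟩
  by_contra hε
  have hexp : Real.exp ε ≤ 1 := by simpa using not_lt.1 hε
  have hle : ∀ v w, R v ≤ R w := fun v w => by
    refine (hR.close v w).le_smul.trans (Measure.le_iff.2 fun E _ => ?_)
    rw [Measure.smul_apply, smul_eq_mul]
    exact mul_le_of_le_one_left zero_le (by simpa using hexp)
  have heq : R e = R (-e) := le_antisymm (hle _ _) (hle _ _)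
  have h1 := (hunb e).2
  rw [heq, (hunb (-e)).2, coe_neg_sphere] at h1
  have h2 : (e : Rd d) = 0 := by
    have : (2 : ℝ) • (e : Rd d) = 0 := by
      rw [two_smul]
      nth_rewrite 1 [← h1]
      exact neg_add_cancel _
    simpa using this
  have h3 : ‖(e : Rd d)‖ = 1 := norm_eq_of_mem_sphere e
  rw [h2, norm_zero] at h3
  exact zero_ne_one h3

/-- The positive part is bounded using μ ≤ c ν and the negative part using ν ≤ μ; for c ≥ 1, max f
(c f) = c f⁺ - f⁻. -/
theorem integral_le_integral_max_of_squeeze {Y : Type*} [MeasurableSpace Y] {μ ν : Measure Y} {c : ℝ}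
    (hc : 1 ≤ c) (h1 : ν ≤ μ) (h2 : μ ≤ ENNReal.ofReal c • ν) {f : Y → ℝ} (hf : Integrable f μ) :
    ∫ y, f y ∂μ ≤ ∫ y, max (f y) (c * f y) ∂ν := by
  have hfν : Integrable f ν := hf.mono_measure h1
  have hpos : ∫ y, max (f y) 0 ∂μ ≤ c * ∫ y, max (f y) 0 ∂ν := by
    have := integral_mono_measure h2 (ae_of_all _ fun y => le_max_right (f y) 0)
      (hfν.pos_part.smul_measure ENNReal.ofReal_ne_top)
    rwa [integral_smul_measure, ENNReal.toReal_ofReal (by linarith), smul_eq_mul] at this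
  have hneg : ∫ y, max (-f y) 0 ∂ν ≤ ∫ y, max (-f y) 0 ∂μ :=
    integral_mono_measure h1 (ae_of_all _ fun y => le_max_right (-f y) 0) hf.neg_part
  have e1 : ∫ y, f y ∂μ = ∫ y, max (f y) 0 ∂μ - ∫ y, max (-f y) 0 ∂μ := by
    rw [← integral_sub hf.pos_part hf.neg_part]
    refine integral_congr_ae (ae_of_all _ fun y => ?_)
    rcases le_total 0 (f y) with h | h <;> simp [h]
  have e2 : ∫ y, max (f y) (c * f y) ∂ν = c * ∫ y, max (f y) 0 ∂ν - ∫ y, max (-f y) 0 ∂ν := by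
    rw [← integral_const_mul, ← integral_sub (hfν.pos_part.const_mul c) hfν.neg_part]
    refine integral_congr_ae (ae_of_all _ fun y => ?_)
    rcases le_total 0 (f y) with h | h
    · have : f y ≤ c * f y := by nlinarith
      simp [h, this]
    · have : c * f y ≤ f y := by nlinarith
      simp [h, this]
  rw [e1, e2]
  linarith

theorem integral_max_inner_sub_norm {n : ℕ} {c l : ℝ}
    (hl : ∀ v : UnitSphere (n + 2),
      ∫ u : UnitSphere (n + 2), max (inner ℝ (u : Rd (n + 2)) (v : Rd (n + 2)) - l)
        (c * (inner ℝ (u : Rd (n + 2)) (v : Rd (n + 2)) - l))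
        ∂(volume : Measure (Rd (n + 2))).toSphere = 0) (z : Rd (n + 2)) :
    ∫ u : UnitSphere (n + 2), max (inner ℝ z (u : Rd (n + 2)) - l * ‖z‖)
        (c * (inner ℝ z (u : Rd (n + 2)) - l * ‖z‖))
        ∂(volume : Measure (Rd (n + 2))).toSphere = 0 := by
  rcases eq_or_ne z 0 with rfl | hz
  · simp
  have hz' : 0 < ‖z‖ := norm_pos_iff.2 hz
  let w : UnitSphere (n + 2) := ⟨‖z‖⁻¹ • z, by simp [norm_smul, hz'.ne']⟩
  have hw : z = ‖z‖ • (w : Rd (n + 2)) := by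
    simp [w, smul_smul, hz'.ne']
  have : ∀ u : UnitSphere (n + 2), max (inner ℝ z (u : Rd (n + 2)) - l * ‖z‖)
        (c * (inner ℝ z (u : Rd (n + 2)) - l * ‖z‖)) =
      ‖z‖ * max (inner ℝ (u : Rd (n + 2)) (w : Rd (n + 2)) - l)
        (c * (inner ℝ (u : Rd (n + 2)) (w : Rd (n + 2)) - l)) := fun u => by
    have hi : inner ℝ z (u : Rd (n + 2)) = ‖z‖ * inner ℝ (u : Rd (n + 2)) (w : Rd (n + 2)) := by
      conv_lhs => rw [hw]
      rw [real_inner_smul_left, real_inner_comm]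
    rw [hi, mul_max_of_nonneg _ _ hz'.le]
    congr 1 <;> ring
  simp_rw [this]
  rw [integral_const_mul, hl w, mul_zero]

/-- Lower bound for the first moment of an unbiased private randomizer. -/
theorem one_le_mul_of_first_moment_le {n : ℕ} {ε l K : ℝ} (hl0 : 0 ≤ l) (hε : 0 ≤ ε)
    (hl : ∀ v : UnitSphere (n + 2),
      ∫ u : UnitSphere (n + 2), max (inner ℝ (u : Rd (n + 2)) (v : Rd (n + 2)) - l)
        (Real.exp ε * (inner ℝ (u : Rd (n + 2)) (v : Rd (n + 2)) - l))
        ∂(volume : Measure (Rd (n + 2))).toSphere = 0)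
    {R : UnitSphere (n + 2) → Measure (Rd (n + 2))}
    (hR : IsDPLocalRandomizer ε R) (hunb : IsUnbiased R) (hK : ∀ v, ∫ z, ‖z‖ ∂(R v) ≤ K) :
    1 ≤ l * K := by
  have hprob := hR.isProbabilityMeasure
  obtain ⟨ν, hν⟩ := hR.exists_squeeze
  let e : UnitSphere (n + 2) := ⟨EuclideanSpace.single 0 1, by simp⟩
  have hνfin : IsFiniteMeasure ν := ⟨((hν e).1 Set.univ).trans_lt (measure_lt_top _ _)⟩
  have hνint : Integrable (fun z : Rd (n + 2) => z) ν := (hunb e).1.mono_measure (hν e).1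
  have hc : 1 ≤ Real.exp ε := Real.one_le_exp hε
  set S := (volume : Measure (Rd (n + 2))).toSphere
  let ψ : Rd (n + 2) → UnitSphere (n + 2) → ℝ := fun z v =>
    max (inner ℝ z (v : Rd (n + 2)) - l * ‖z‖)
      (Real.exp ε * (inner ℝ z (v : Rd (n + 2)) - l * ‖z‖))
  -- The squeeze is applied to f(z) = ⟪z, v⟫ - l‖z‖; unbiasedness makes the mean of ⟪z, v⟫ equal to
  -- 1.
  have hψ : ∀ v, 1 - l * K ≤ ∫ z, ψ z v ∂ν := by
    intro v
    have hi1 : Integrable (fun z : Rd (n + 2) => inner ℝ z (v : Rd (n + 2))) (R v) :=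
      (hunb v).1.inner_const _
    have hi2 : Integrable (fun z : Rd (n + 2) => l * ‖z‖) (R v) := (hunb v).1.norm.const_mul l
    have hone : ∫ z, inner ℝ z (v : Rd (n + 2)) ∂(R v) = 1 := by
      have := integral_inner (𝕜 := ℝ) (hunb v).1 (v : Rd (n + 2))
      rw [(hunb v).2, real_inner_self_eq_norm_sq, norm_eq_of_mem_sphere] at this
      simp_rw [real_inner_comm] at this ⊢
      simpa using this
    have h := integral_le_integral_max_of_squeeze hc (hν v).1 (hν v).2 (hi1.sub hi2)
    simp only [Pi.sub_apply] at h
    rw [integral_sub hi1 hi2, hone, integral_const_mul] at h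
    refine le_trans ?_ h
    have := mul_le_mul_of_nonneg_left (hK v) hl0
    linarith
  have hprod : Integrable (Function.uncurry ψ) (ν.prod S) := by
    have hdom : Integrable (fun p : Rd (n + 2) × UnitSphere (n + 2) =>
        Real.exp ε * ((1 + l) * ‖p.1‖)) (ν.prod S) :=
      ((hνint.norm.comp_fst S).const_mul (1 + l)).const_mul _
    refine hdom.mono' ?_ (ae_of_all _ fun p => ?_)
    · apply Continuous.aestronglyMeasurable
      unfold Function.uncurry
      fun_prop
    · obtain ⟨z, v⟩ := p
      have hin : |inner ℝ z (v : Rd (n + 2)) - l * ‖z‖| ≤ (1 + l) * ‖z‖ := by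
        have h1 : |inner ℝ z (v : Rd (n + 2))| ≤ ‖z‖ := by
          simpa using abs_real_inner_le_norm z (v : Rd (n + 2))
        have h2 := abs_sub (inner ℝ z (v : Rd (n + 2))) (l * ‖z‖)
        rw [abs_of_nonneg (show 0 ≤ l * ‖z‖ by positivity)] at h2
        linarith
      have hpos : 0 ≤ (1 + l) * ‖z‖ := by positivity
      simp only [Function.uncurry, ψ, Real.norm_eq_abs]
      refine abs_max_le_max_abs_abs.trans (max_le ?_ ?_)
      · exact hin.trans (le_mul_of_one_le_left hpos hc)
      · rw [abs_mul, abs_of_pos (Real.exp_pos ε)]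
        gcongr
  -- The measure ν does not depend on v, so Fubini lets the v-integral act first, where the root
  -- equation kills it for every z.
  have hswap : ∫ v, ∫ z, ψ z v ∂ν ∂S = 0 := by
    rw [← integral_integral_swap hprod]
    have : ∀ z, ∫ v, ψ z v ∂S = 0 := integral_max_inner_sub_norm hl
    simp_rw [this, integral_zero]
  have hSpos : 0 < S.real Set.univ := by
    rw [measureReal_def, ENNReal.toReal_pos_iff]
    refine ⟨pos_iff_ne_zero.2 ?_, measure_lt_top _ _⟩
    rw [ne_eq, Measure.measure_univ_eq_zero]
    exact Measure.toSphere_ne_zero _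
  have hmono : ∫ _ : UnitSphere (n + 2), (1 - l * K) ∂S ≤ ∫ v, ∫ z, ψ z v ∂ν ∂S :=
    integral_mono (integrable_const _) hprod.swap.integral_prod_left hψ
  rw [hswap, integral_const, smul_eq_mul] at hmono
  have := nonpos_of_mul_nonpos_right hmono hSpos
  linarith

theorem lintegral_norm_sub_sq_eq {d : ℕ} {μ : Measure (Rd d)} [IsProbabilityMeasure μ]
    {v : UnitSphere d} (hint : Integrable (fun z : Rd d => z) μ) (hv : ∫ z, z ∂μ = (v : Rd d))
    (h2 : Integrable (fun z : Rd d => ‖z‖ ^ 2) μ) :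
    ∫⁻ z, ENNReal.ofReal (‖z - (v : Rd d)‖ ^ 2) ∂μ = ENNReal.ofReal (∫ z, ‖z‖ ^ 2 ∂μ - 1) := by
  have hi : Integrable (fun z : Rd d => inner ℝ z (v : Rd d)) μ := hint.inner_const _
  have hone : ∫ z, inner ℝ z (v : Rd d) ∂μ = 1 := by
    have := integral_inner (𝕜 := ℝ) hint (v : Rd d)
    rw [hv, real_inner_self_eq_norm_sq, norm_eq_of_mem_sphere] at this
    simp_rw [real_inner_comm] at this ⊢
    simpa using this
  have hexp : ∀ z : Rd d, ‖z - (v : Rd d)‖ ^ 2 = ‖z‖ ^ 2 - 2 * inner ℝ z (v : Rd d) + 1 := fun z => by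
    rw [norm_sub_sq_real, norm_eq_of_mem_sphere]; ring
  have hI : Integrable (fun z : Rd d => ‖z‖ ^ 2 - 2 * inner ℝ z (v : Rd d) + 1) μ :=
    (h2.sub (hi.const_mul 2)).add (integrable_const _)
  rw [← ofReal_integral_eq_lintegral_ofReal (by simpa only [hexp] using hI)
    (ae_of_all _ fun z => by positivity)]
  simp_rw [hexp]
  have hI2 : Integrable (fun z : Rd d => ‖z‖ ^ 2 - 2 * inner ℝ z (v : Rd d)) μ :=
    h2.sub (hi.const_mul 2)
  rw [integral_add hI2 (integrable_const _), integral_sub h2 (hi.const_mul 2),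
    integral_const_mul, hone]
  congr 1
  simp
  ring

/-- Finite error gives a second moment, at most err + 1 by unbiasedness; nonnegativity of the
variance of ‖z‖ then bounds the first moment. -/
theorem first_moment_le_sqrt_err {d : ℕ} {R : UnitSphere d → Measure (Rd d)}
    (hprob : ∀ v, IsProbabilityMeasure (R v)) (hunb : IsUnbiased R) (herr : err R ≠ ∞)
    (v : UnitSphere d) : ∫ z, ‖z‖ ∂(R v) ≤ √((err R).toReal + 1) := by
  have hle : ∫⁻ z, ENNReal.ofReal (‖z - (v : Rd d)‖ ^ 2) ∂(R v) ≤ err R :=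
    le_iSup (fun v : UnitSphere d => ∫⁻ z, ENNReal.ofReal (‖z - (v : Rd d)‖ ^ 2) ∂(R v)) v
  have hint := (hunb v).1
  have hsub : MemLp (fun z : Rd d => z - (v : Rd d)) 2 (R v) := by
    refine (memLp_two_iff_integrable_sq_norm
      (hint.sub (integrable_const (v : Rd d))).aestronglyMeasurable).2 ?_
    refine ⟨by fun_prop, ?_⟩
    rw [hasFiniteIntegral_iff_ofReal (ae_of_all _ fun z => by positivity)]
    exact hle.trans_lt herr.lt_top
  have hmem : MemLp (fun z : Rd d => z) 2 (R v) := by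
    have := hsub.add (memLp_const (v : Rd d))
    simpa [Pi.add_def] using this
  have h2 : Integrable (fun z : Rd d => ‖z‖ ^ 2) (R v) :=
    (memLp_two_iff_integrable_sq_norm hint.aestronglyMeasurable).1 hmem
  rw [lintegral_norm_sub_sq_eq hint (hunb v).2 h2] at hle
  have h3 : ∫ z, ‖z‖ ^ 2 ∂(R v) ≤ (err R).toReal + 1 := by
    have := (ENNReal.ofReal_le_iff_le_toReal herr).1 hle
    linarith
  refine Real.le_sqrt_of_sq_le (le_trans ?_ h3)
  have hm : MemLp (fun z : Rd d => ‖z‖) 2 (R v) := hmem.norm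
  have := ProbabilityTheory.variance_nonneg (fun z : Rd d => ‖z‖) (R v)
  rw [ProbabilityTheory.variance_eq_sub hm] at this
  simp only [Pi.pow_apply] at this
  linarith

/-! ### PrivUnit at the threshold -/

/-- The mixture of surface measure on a cap with weight `x` and on its complement with weight
`y`. -/
noncomputable def capMixture {d : ℕ} (l x y : ℝ) (v : UnitSphere d) : Measure (UnitSphere d) :=
  ENNReal.ofReal x • (volume : Measure (Rd d)).toSphere.restrict (sphereCap v l) +
    ENNReal.ofReal y • (volume : Measure (Rd d)).toSphere.restrict (sphereCap v l)ᶜ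

theorem integral_capMixture {d : ℕ} {l x y : ℝ} (hx : 0 ≤ x) (hy : 0 ≤ y) (v : UnitSphere d)
    {F : Type*} [NormedAddCommGroup F] [NormedSpace ℝ F] [SecondCountableTopology F]
    {f : UnitSphere d → F} (hf : Continuous f) :
    ∫ u, f u ∂(capMixture l x y v) =
      x • ∫ u in sphereCap v l, f u ∂(volume : Measure (Rd d)).toSphere +
      y • ∫ u in (sphereCap v l)ᶜ, f u ∂(volume : Measure (Rd d)).toSphere := by
  have hint := integrable_of_continuous_toSphere hf
  rw [capMixture, integral_add_measure (hint.integrableOn.smul_measure ENNReal.ofReal_ne_top)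
    (hint.integrableOn.smul_measure ENNReal.ofReal_ne_top), integral_smul_measure,
    integral_smul_measure, ENNReal.toReal_ofReal hx, ENNReal.toReal_ofReal hy]

instance isFiniteMeasure_capMixture {d : ℕ} (l x y : ℝ) (v : UnitSphere d) :
    IsFiniteMeasure (capMixture l x y v) := by
  unfold capMixture
  have h1 : IsFiniteMeasure
      (ENNReal.ofReal x • (volume : Measure (Rd d)).toSphere.restrict (sphereCap v l)) :=
    Measure.smul_finite _ ENNReal.ofReal_ne_top
  have h2 : IsFiniteMeasure
      (ENNReal.ofReal y • (volume : Measure (Rd d)).toSphere.restrict (sphereCap v l)ᶜ) :=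
    Measure.smul_finite _ ENNReal.ofReal_ne_top
  infer_instance

theorem capMixture_apply {d : ℕ} (l x y : ℝ) (v : UnitSphere d) {E : Set (UnitSphere d)}
    (hE : MeasurableSet E) :
    capMixture l x y v E =
      ENNReal.ofReal x * (volume : Measure (Rd d)).toSphere (E ∩ sphereCap v l) +
      ENNReal.ofReal y * (volume : Measure (Rd d)).toSphere (E ∩ (sphereCap v l)ᶜ) := by
  simp only [capMixture, Measure.add_apply, Measure.smul_apply, smul_eq_mul,
    Measure.restrict_apply hE]

theorem capMixture_le {d : ℕ} {l x y : ℝ} (hyx : y ≤ x) (v : UnitSphere d)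
    {E : Set (UnitSphere d)} (hE : MeasurableSet E) :
    capMixture l x y v E ≤ ENNReal.ofReal x * (volume : Measure (Rd d)).toSphere E := by
  rw [capMixture_apply l x y v hE, ← measure_inter_add_sdiff E (measurableSet_sphereCap v l),
    mul_add, Set.sdiff_eq]
  gcongr

theorem le_capMixture {d : ℕ} {l x y : ℝ} (hyx : y ≤ x) (v : UnitSphere d)
    {E : Set (UnitSphere d)} (hE : MeasurableSet E) :
    ENNReal.ofReal y * (volume : Measure (Rd d)).toSphere E ≤ capMixture l x y v E := by
  rw [capMixture_apply l x y v hE, ← measure_inter_add_sdiff E (measurableSet_sphereCap v l),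
    mul_add, Set.sdiff_eq]
  gcongr

/-- The cap relation is measurable jointly in input and point, so the measures of its sections
depend measurably on the input. -/
theorem measurable_capMixture {d : ℕ} (l x y : ℝ) :
    Measurable (capMixture (d := d) l x y) := by
  refine Measure.measurable_of_measurable_coe _ fun E hE => ?_
  simp_rw [capMixture_apply l x y _ hE]
  have hcap : MeasurableSet {p : UnitSphere d × UnitSphere d |
      l ≤ inner ℝ (p.2 : Rd d) (p.1 : Rd d)} :=
    measurableSet_le measurable_const (by fun_prop)
  have h1 := measurable_measure_prodMk_left (ν := (volume : Measure (Rd d)).toSphere)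
    ((hE.preimage measurable_snd).inter hcap)
  have h2 := measurable_measure_prodMk_left (ν := (volume : Measure (Rd d)).toSphere)
    ((hE.preimage measurable_snd).inter hcap.compl)
  exact (h1.const_mul _).add (h2.const_mul _)

theorem privUnit_eq_map_capMixture {d : ℕ} {p γ a b : ℝ} (hp0 : 0 ≤ p) (hp1 : p ≤ 1)
    (ha : 0 < a) (hb : 0 < b) {v : UnitSphere d}
    (hva : (volume : Measure (Rd d)).toSphere.real (sphereCap v γ) = a)
    (hvb : (volume : Measure (Rd d)).toSphere.real (sphereCap v γ)ᶜ = b) :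
    privUnit d p γ v = (capMixture γ (p / a) ((1 - p) / b) v).map
      (fun u : UnitSphere d => (1 / privUnitNorm d p γ) • (u : Rd d)) := by
  have hp1' : 0 ≤ 1 - p := by linarith
  rw [privUnit, capMixture, uniformOnSphere, uniformOnSphere, ← compl_sphereCap,
    ProbabilityTheory.cond, ProbabilityTheory.cond, smul_smul, smul_smul,
    ← ofReal_measureReal (μ := (volume : Measure (Rd d)).toSphere) (s := (sphereCap v γ)ᶜ), hvb,
    ← ofReal_measureReal (μ := (volume : Measure (Rd d)).toSphere) (s := sphereCap v γ), hva,
    ← ENNReal.ofReal_inv_of_pos ha, ← ENNReal.ofReal_inv_of_pos hb, ← ENNReal.ofReal_mul hp0,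
    ← ENNReal.ofReal_mul hp1', div_eq_mul_inv p, div_eq_mul_inv (1 - p)]

/-- Let a, b be the masses of the cap and its complement, and A the cap moment. Normalizing the
weights c and 1 gives Z = c a + b and p = c a / Z. The root equation reads (c - 1) A = l Z, and (c -
1) A / Z is both the length of the mean and the constant m. -/
theorem exists_privUnit_of_threshold {n : ℕ} {ε l : ℝ} (hε : 0 < ε) (hl0 : 0 < l) (hl1 : l < 1)
    (hl : ∀ v : UnitSphere (n + 2),
      ∫ u : UnitSphere (n + 2), max (inner ℝ (u : Rd (n + 2)) (v : Rd (n + 2)) - l)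
        (Real.exp ε * (inner ℝ (u : Rd (n + 2)) (v : Rd (n + 2)) - l))
        ∂(volume : Measure (Rd (n + 2))).toSphere = 0) :
    ∃ p ∈ Set.Icc (0 : ℝ) 1, ∃ Z : ℝ, 0 < Z ∧
      (∀ v : UnitSphere (n + 2), privUnit (n + 2) p l v =
        (capMixture l (Real.exp ε / Z) (1 / Z) v).map
          (fun u : UnitSphere (n + 2) => l⁻¹ • (u : Rd (n + 2)))) ∧
      (∀ v : UnitSphere (n + 2), IsProbabilityMeasure (capMixture l (Real.exp ε / Z) (1 / Z) v)) ∧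
      ∀ v : UnitSphere (n + 2), ∫ u, (u : Rd (n + 2)) ∂(capMixture l (Real.exp ε / Z) (1 / Z) v) =
        l • (v : Rd (n + 2)) := by
  obtain ⟨a, b, A, ha, hb, hA, hv, hnorm⟩ := exists_cap_moments n (γ := l) (by linarith) hl1
  let e : UnitSphere (n + 2) := ⟨EuclideanSpace.single 0 1, by simp⟩
  have hc := Real.exp_pos ε
  have hroot : Real.exp ε * (A - l * a) + (-A - l * b) = 0 := by
    have h := hl e
    rw [integral_max_mul_sub_eq e (Real.one_le_exp hε.le)] at h
    obtain ⟨h1, h2, h3, h4⟩ := hv e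
    rwa [h1, h2, h3, h4] at h
  set c := Real.exp ε
  obtain ⟨Z, hZdef⟩ : ∃ Z, Z = c * a + b := ⟨_, rfl⟩
  have hZ : 0 < Z := hZdef ▸ by positivity
  have hlZ : l * Z = (c - 1) * A := by rw [hZdef]; linarith
  have hp : 1 - c * a / Z = b / Z := by rw [hZdef] at hZ ⊢; field_simp; ring
  have hpa : c * a / Z / a = c / Z := by field_simp
  have hpb : (1 - c * a / Z) / b = 1 / Z := by rw [hp]; field_simp
  have hp0 : 0 ≤ c * a / Z := by positivity
  have hp1 : c * a / Z ≤ 1 := by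
    have : 0 ≤ b / Z := by positivity
    linarith
  have hm : privUnitNorm (n + 2) (c * a / Z) l = l := by
    rw [hnorm, hpa, hpb]
    field_simp
    linarith
  refine ⟨c * a / Z, ⟨hp0, hp1⟩, Z, hZ, fun v => ?_, fun v => ⟨?_⟩, fun v => ?_⟩
  · obtain ⟨h1, h2, -, -⟩ := hv v
    rw [privUnit_eq_map_capMixture hp0 hp1 ha hb h1 h2, hpa, hpb, hm, one_div l]
  · obtain ⟨h1, h2, -, -⟩ := hv v
    rw [capMixture_apply _ _ _ _ MeasurableSet.univ, Set.univ_inter, Set.univ_inter,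
      ← ofReal_measureReal (μ := (volume : Measure (Rd (n + 2))).toSphere) (s := (sphereCap v l)ᶜ),
      h2, ← ofReal_measureReal (μ := (volume : Measure (Rd (n + 2))).toSphere) (s := sphereCap v l),
      h1, ← ENNReal.ofReal_mul (by positivity), ← ENNReal.ofReal_mul (by positivity),
      ← ENNReal.ofReal_add (by positivity) (by positivity), ENNReal.ofReal_eq_one]
    rw [hZdef] at hZ ⊢
    field_simp
  · obtain ⟨-, -, h3, h4⟩ := hv v
    have e3 := setIntegral_inner_preimage_eq v (B := Set.Ici l)
    have e4 := setIntegral_inner_preimage_eq v (B := Set.Iio l)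
    rw [compl_sphereCap] at h4
    rw [integral_capMixture (by positivity) (by positivity) v continuous_subtype_val,
      compl_sphereCap]
    have e3' := e3.trans (congrArg (· • (v : Rd (n + 2))) h3)
    have e4' := e4.trans (congrArg (· • (v : Rd (n + 2))) h4)
    refine (congrArg₂ (fun s t => (c / Z) • s + (1 / Z) • t) e3' e4').trans ?_
    simp only [smul_smul, ← add_smul]
    congr 1
    field_simp
    linarith

/-- Every mixture has density between 1/Z and e^ε/Z with respect to the same surface measure; the
bound passes to preimages under the common map g. -/
theorem dpClose_map_capMixture {d : ℕ} {ε l Z : ℝ} (hε : 0 ≤ ε) (hZ : 0 < Z) (v w : UnitSphere d)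
    {g : UnitSphere d → Rd d} (hg : Measurable g) :
    DPClose ε ((capMixture l (Real.exp ε / Z) (1 / Z) v).map g)
      ((capMixture l (Real.exp ε / Z) (1 / Z) w).map g) := by
  have hyx : 1 / Z ≤ Real.exp ε / Z := by
    gcongr
    exact Real.one_le_exp hε
  have key : ∀ (v w : UnitSphere d) (E : Set (UnitSphere d)), MeasurableSet E →
      (capMixture l (Real.exp ε / Z) (1 / Z) v).real E ≤
        Real.exp ε * (capMixture l (Real.exp ε / Z) (1 / Z) w).real E := by
    intro v w E hE
    have h1 := ENNReal.toReal_mono (by finiteness) (capMixture_le (l := l) hyx v hE)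
    have h2 := ENNReal.toReal_mono (by finiteness) (le_capMixture (l := l) hyx w hE)
    rw [ENNReal.toReal_mul, ENNReal.toReal_ofReal (by positivity)] at h1 h2
    have h3 := mul_le_mul_of_nonneg_left h2 (Real.exp_pos ε).le
    rw [← mul_assoc, mul_one_div] at h3
    exact h1.trans h3
  intro E hE
  simp only [measureReal_def, Measure.map_apply hg hE]
  refine ⟨?_, key w v _ (hg hE)⟩
  have := mul_le_mul_of_nonneg_left (key v w _ (hg hE)) (Real.exp_pos (-ε)).le
  rwa [← mul_assoc, ← Real.exp_add, neg_add_cancel, Real.exp_zero, one_mul] at this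

/-! ### Optimality of PrivUnit -/

theorem mainTheorem2 (d : ℕ) (hd : 2 ≤ d) (ε : ℝ) (R : UnitSphere d → Measure (Rd d))
    (hR : IsDPLocalRandomizer ε R) (hunb : IsUnbiased R) :
    ∃ p ∈ Set.Icc (0 : ℝ) 1, ∃ γ ∈ Set.Icc (0 : ℝ) 1,
      IsDPLocalRandomizer ε (privUnit d p γ) ∧ IsUnbiased (privUnit d p γ) ∧
        err (privUnit d p γ) ≤ err R := by
  -- With d = n + 2, the exponent of sine in the law of ⟪u, v⟫ is n.
  obtain ⟨n, rfl⟩ := Nat.exists_eq_add_of_le' hd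
  have hε := hR.eps_pos (by omega) hunb
  obtain ⟨l, ⟨hl0, hl1⟩, hl⟩ := exists_threshold n (Real.one_lt_exp_iff.2 hε)
  obtain ⟨p, hp, Z, hZ, hmap, hprob, hmean⟩ := exists_privUnit_of_threshold hε hl0 hl1 hl
  have hg : Measurable fun u : UnitSphere (n + 2) => l⁻¹ • (u : Rd (n + 2)) := by fun_prop
  have hprob' : ∀ v, IsProbabilityMeasure (privUnit (n + 2) p l v) := fun v => by
    rw [hmap v]
    exact Measure.isProbabilityMeasure_map hg.aemeasurable
  have hnorm : ∀ v, ∀ᵐ z ∂(privUnit (n + 2) p l v), ‖z‖ = l⁻¹ := fun v => by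
    rw [hmap v, ae_map_iff hg.aemeasurable (measurableSet_eq_fun measurable_norm measurable_const)]
    exact ae_of_all _ fun u => by simp [norm_smul, abs_of_pos hl0]
  have hunb' : IsUnbiased (privUnit (n + 2) p l) := by
    refine fun v => ⟨?_, ?_⟩
    · refine Integrable.of_bound (by fun_prop) l⁻¹ ?_
      filter_upwards [hnorm v] with z hz using hz.le
    · rw [hmap v, integral_map hg.aemeasurable (by fun_prop), integral_smul, hmean v, smul_smul,
        inv_mul_cancel₀ hl0.ne', one_smul]
  refine ⟨p, hp, l, ⟨hl0.le, hl1.le⟩, ⟨?_, hprob', fun v w => ?_⟩, hunb', ?_⟩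
  · rw [funext hmap]
    exact (Measure.measurable_map _ hg).comp (measurable_capMixture _ _ _)
  · rw [hmap v, hmap w]
    exact dpClose_map_capMixture hε.le hZ v w hg
  · rcases eq_or_ne (err R) ∞ with htop | htop
    · rw [htop]; exact le_top
    have hsq : ∀ v, (fun z : Rd (n + 2) => ‖z‖ ^ 2) =ᵐ[privUnit (n + 2) p l v]
        fun _ => l⁻¹ ^ 2 := fun v => by
      filter_upwards [hnorm v] with z hz
      rw [hz]
    have hK := one_le_mul_of_first_moment_le hl0.le hε.le hl hR hunb
      (first_moment_le_sqrt_err hR.isProbabilityMeasure hunb htop)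
    refine iSup_le fun v => ?_
    rw [lintegral_norm_sub_sq_eq (hunb' v).1 (hunb' v).2
      ((integrable_congr (hsq v)).2 (integrable_const _)), integral_congr_ae (hsq v)]
    simp only [integral_const, probReal_univ, one_smul]
    rw [ENNReal.ofReal_le_iff_le_toReal htop]
    -- The error of PrivUnit is l⁻² - 1 at every input, so 1 ≤ l √(err R + 1) is exactly the
    -- required comparison.
    have h1 : l⁻¹ ≤ √((err R).toReal + 1) := by
      rwa [inv_le_iff_one_le_mul₀' hl0]
    have h2 : l⁻¹ ^ 2 ≤ (err R).toReal + 1 := by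
      have := pow_le_pow_left₀ (by positivity) h1 2
      rwa [Real.sq_sqrt (by positivity)] at this
    linarith
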